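/- For a positive integer $m$ let $\Phi_m(q)$ be the $m$-th cyclotomic polynomial, let $[m]_q=1+q+\cdots+q^{m-1}$ (so that $[m]_{q^2}=1+q^2+\cdots+q^{2(m-1)}$), and let $(a;q)_0=1$ and $(a;q)_k=(1-a)(1-aq)\cdots(1-aq^{k-1})$ for $k\geqslant 1$. For rational functions $A(q),B(q)\in\mathbb{Q}(q)$ and a polynomial $P(q)\in\mathbb{Q}[q]$, write $A(q)\equiv B(q)\pmod{P(q)}$ if $P(q)$ divides the numerator of $A(q)-B(q)$ written in lowest terms. Theorem. Let $n$ and $r$ be positive integers with $n\equiv 3\pmod 4$. Then, modulo $\Phi_{n^{2r}}(q)^2\prod_{j=1}^{r}\Phi_{n^{2j-1}}(q)^2$, we have $$\sum_{k=0}^{(n^{2r}-1)/2}\frac{(1+q^{4k+1})(q^2;q^4)_k^3}{(1+q)(q^4;q^4)_k^3}\,q^k\equiv \frac{[n^{2r}]_{q^2}\,(q^3;q^4)_{(n^{2r}-1)/2}}{(q^5;q^4)_{(n^{2r}-1)/2}}\,q^{(1-n^{2r})/2}$$ and $$\sum_{k=0}^{n^{2r}-1}\frac{(1+q^{4k+1})(q^2;q^4)_k^3}{(1+q)(q^4;q^4)_k^3}\,q^k\equiv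 \frac{[n^{2r}]_{q^2}\,(q^3;q^4)_{(n^{2r}-1)/2}}{(q^5;q^4)_{(n^{2r}-1)/2}}\,q^{(1-n^{2r})/2}.$$ -/

import Mathlib

open Polynomial

/-- The `q`-shifted factorial `(a;q)_k = (1 - a)(1 - a q) ⋯ (1 - a q ^ (k - 1))`. -/
def qShiftedFactorial {R : Type*} [CommRing R] (a q : R) (k : ℕ) : R :=
  ∏ i ∈ Finset.range k, (1 - a * q ^ i)

/-- The `q`-integer `[k]_q = 1 + q + ⋯ + q ^ (k - 1)`. -/
def qInteger {R : Type*} [CommRing R] (q : R) (k : ℕ) : R :=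
  ∑ i ∈ Finset.range k, q ^ i

/-- Congruence of two rational functions modulo a polynomial `P`: the polynomial `P` divides the
numerator of their difference, written in lowest terms. -/
def RatCongr (P : ℚ[X]) (A B : RatFunc ℚ) : Prop :=
  P ∣ (A - B).num

/-- The truncated sum
`∑_{k=0}^{M} (1 + q^{4k+1}) (q^2;q^4)_k^3 / ((1 + q) (q^4;q^4)_k^3) * q^k`. -/
noncomputable def truncatedSum {K : Type*} [Field K] (q : K) (M : ℕ) : K :=
  ∑ k ∈ Finset.range (M + 1),
    (1 + q ^ (4 * k + 1)) * qShiftedFactorial (q ^ 2) (q ^ 4) k ^ 3 /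
      ((1 + q) * qShiftedFactorial (q ^ 4) (q ^ 4) k ^ 3) * q ^ k

/-- The rational function
`[N]_{q^2} (q^3;q^4)_{(N-1)/2} / (q^5;q^4)_{(N-1)/2} * q^{(1-N)/2}`, for odd `N`. -/
noncomputable def closedForm {K : Type*} [Field K] (q : K) (N : ℕ) : K :=
  qInteger (q ^ 2) N * qShiftedFactorial (q ^ 3) (q ^ 4) ((N - 1) / 2) /
    qShiftedFactorial (q ^ 5) (q ^ 4) ((N - 1) / 2) * q ^ ((1 - (N : ℤ)) / 2)

/-!
Two of the three shifted factorials above and below are deformed by a parameter `t`. At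
`t = q ^ (2 N)` with `N` odd, the deformed series terminates and is a very-well-poised `₆φ₅`, which
Rogers' summation evaluates to the right-hand side. Let `d ∣ N`. Cut the series into blocks of `d`
consecutive terms. Since `Φ_d(q)` divides `1 - t`, the deformation multiplies all terms of a block
by the same factor modulo `Φ_d(q) ^ 2`, the terms in the second half of a block being themselves
divisible by `Φ_d(q) ^ 3`; for the same reason both truncations agree. For `d = N` there is a
single block, whose factor is `1`. For `d ≡ 3 (mod 4)` the right-hand side is divisible by
`Φ_d(q) ^ 2`, and applying the evaluation to `N = d, 3 d, 5 d, …` shows inductively that the sum of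
every block is divisible by `Φ_d(q) ^ 2`.
-/

section QShiftedFactorial

variable {R K : Type*} [CommRing R] [Field K]

theorem qShiftedFactorial_zero (a q : R) : qShiftedFactorial a q 0 = 1 :=
  Finset.prod_range_zero _

theorem qShiftedFactorial_succ (a q : R) (k : ℕ) :
    qShiftedFactorial a q (k + 1) = qShiftedFactorial a q k * (1 - a * q ^ k) :=
  Finset.prod_range_succ _ _

theorem qShiftedFactorial_succ' (a q : R) (k : ℕ) :
    qShiftedFactorial a q (k + 1) = (1 - a) * qShiftedFactorial (a * q) q k := by
  simp only [qShiftedFactorial, Finset.prod_range_succ', pow_zero, mul_one, pow_succ', mul_assoc]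
  exact mul_comm _ _

theorem one_sub_mul_qShiftedFactorial_mul (a q : R) (k : ℕ) :
    (1 - a) * qShiftedFactorial (a * q) q k = qShiftedFactorial a q k * (1 - a * q ^ k) := by
  rw [← qShiftedFactorial_succ', qShiftedFactorial_succ]

theorem qInteger_mul_one_sub (q : R) (k : ℕ) : qInteger q k * (1 - q) = 1 - q ^ k :=
  geom_sum_mul_neg q k

theorem qShiftedFactorial_ne_zero {a q : K} (h : ∀ i, 1 - a * q ^ i ≠ 0) (k : ℕ) :
    qShiftedFactorial a q k ≠ 0 :=
  Finset.prod_ne_zero_iff.mpr fun i _ ↦ h i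

theorem qShiftedFactorial_div_succ_mul (a : K) {b q : K} {k : ℕ} (h : 1 - b * q ^ k ≠ 0) :
    qShiftedFactorial a q (k + 1) / qShiftedFactorial b q (k + 1) * (1 - b * q ^ k) =
      qShiftedFactorial a q k / qShiftedFactorial b q k * (1 - a * q ^ k) := by
  rw [qShiftedFactorial_succ, qShiftedFactorial_succ, mul_div_mul_comm, mul_assoc,
    div_mul_cancel₀ _ h]

theorem qShiftedFactorial_mul_div_mul (a : K) {b q : K} (h : ∀ i, 1 - b * q ^ i ≠ 0) (k : ℕ) :
    qShiftedFactorial (a * q) q k / qShiftedFactorial b q k * ((1 - a) * (1 - b)) =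
      qShiftedFactorial a q k / qShiftedFactorial (b * q) q k *
        ((1 - a * q ^ k) * (1 - b * q ^ k)) := by
  have hnum := one_sub_mul_qShiftedFactorial_mul a q k
  have hden := one_sub_mul_qShiftedFactorial_mul b q k
  have hb := qShiftedFactorial_ne_zero h k
  have hbq : qShiftedFactorial (b * q) q k ≠ 0 :=
    right_ne_zero_of_mul (hden ▸ mul_ne_zero hb (h k))
  rw [div_mul_eq_mul_div, div_mul_eq_mul_div, div_eq_div_iff hb hbq]
  linear_combination (1 - b) * qShiftedFactorial (b * q) q k * hnum +
    qShiftedFactorial a q k * (1 - a * q ^ k) * hden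

theorem qShiftedFactorial_inv_pow_eq_zero {q : K} (hq : q ≠ 0) {m k : ℕ} (hmk : m < k) :
    qShiftedFactorial (q ^ m)⁻¹ q k = 0 :=
  Finset.prod_eq_zero (Finset.mem_range.mpr hmk) <| by
    rw [inv_mul_cancel₀ (pow_ne_zero m hq), sub_self]

theorem qShiftedFactorial_reflect {a q : K} (ha : a ≠ 0) (hq : q ≠ 0) (m : ℕ) :
    qShiftedFactorial (q / (a * q ^ m)) q m * ((-a) ^ m * q ^ m.choose 2) =
      qShiftedFactorial a q m := by
  induction m with
  | zero => simp [qShiftedFactorial_zero]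
  | succ m ih =>
    have hshift : q / (a * q ^ (m + 1)) * q = q / (a * q ^ m) := by field
    have hfactor : (1 - q / (a * q ^ (m + 1))) * (-a * q ^ m) = 1 - a * q ^ m := by field
    rw [qShiftedFactorial_succ', hshift, qShiftedFactorial_succ, ← ih, ← hfactor,
      Nat.choose_succ_succ', Nat.choose_one_right]
    ring

theorem qShiftedFactorial_reflect_mul {a b q : K} (ha : a ≠ 0) (hb : b ≠ 0) (hq : q ≠ 0) (m : ℕ) :
    qShiftedFactorial (q / (a * q ^ m)) q m * qShiftedFactorial b q m * a ^ m =
      qShiftedFactorial (q / (b * q ^ m)) q m * qShiftedFactorial a q m * b ^ m := by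
  rw [← qShiftedFactorial_reflect ha hq m, ← qShiftedFactorial_reflect hb hq m, neg_pow a,
    neg_pow b]
  ring

end QShiftedFactorial

section VeryWellPoised

variable {K : Type*} [Field K]

/-- The summand of the well-poised series `₄φ₃(a, b, c, d; aq/b, aq/c, aq/d; q, z)`. -/
def wellPoisedTerm (a b c d q z : K) (k : ℕ) : K :=
  qShiftedFactorial a q k / qShiftedFactorial q q k *
    (qShiftedFactorial b q k / qShiftedFactorial (a * q / b) q k) *
    (qShiftedFactorial c q k / qShiftedFactorial (a * q / c) q k) *
    (qShiftedFactorial d q k / qShiftedFactorial (a * q / d) q k) * z ^ k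

/-- The summand of the very-well-poised series `₆φ₅` with parameters `a; b, c, d` and base `q`,
at the argument `aq / (bcd)` at which it is summable in closed form. The quotients
`(± q √a; q)_k / (± √a; q)_k` appear multiplied out, as `(1 - a q ^ (2 k)) / (1 - a)`. -/
def veryWellPoisedTerm (a b c d q : K) (k : ℕ) : K :=
  (1 - a * q ^ (2 * k)) / (1 - a) * wellPoisedTerm a b c d q (a * q / (b * c * d)) k

variable {a b c d q : K}

theorem wellPoisedTerm_mul_argument (z : K) (k : ℕ) :
    wellPoisedTerm a b c d q (z * q) k = q ^ k * wellPoisedTerm a b c d q z k := by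
  simp only [wellPoisedTerm, mul_pow]
  ring

theorem wellPoisedTerm_zero (z : K) : wellPoisedTerm a b c d q z 0 = 1 := by
  simp [wellPoisedTerm, qShiftedFactorial_zero]

theorem wellPoisedTerm_eq_zero {k : ℕ} (hc : qShiftedFactorial c q k = 0) (z : K) :
    wellPoisedTerm a b c d q z k = 0 := by
  simp [wellPoisedTerm, hc]

theorem wellPoisedTerm_succ (hq : ∀ i : ℕ, 1 - q * q ^ i ≠ 0)
    (hb : ∀ i : ℕ, 1 - a * q / b * q ^ i ≠ 0) (hc : ∀ i : ℕ, 1 - a * q / c * q ^ i ≠ 0)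
    (hd : ∀ i : ℕ, 1 - a * q / d * q ^ i ≠ 0) (z : K) (k : ℕ) :
    wellPoisedTerm a b c d q z (k + 1) *
        ((1 - q * q ^ k) * (1 - a * q / b * q ^ k) * (1 - a * q / c * q ^ k) *
          (1 - a * q / d * q ^ k)) =
      wellPoisedTerm a b c d q z k *
        (z * (1 - a * q ^ k) * (1 - b * q ^ k) * (1 - c * q ^ k) * (1 - d * q ^ k)) := by
  have ha' := qShiftedFactorial_div_succ_mul a (hq k)
  have hb' := qShiftedFactorial_div_succ_mul b (hb k)
  have hc' := qShiftedFactorial_div_succ_mul c (hc k)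
  have hd' := qShiftedFactorial_div_succ_mul d (hd k)
  simp only [wellPoisedTerm, pow_succ z]
  linear_combination z ^ k * z * congr($ha' * $hb' * $hc' * $hd')

theorem wellPoisedTerm_mul_base (hc : ∀ i : ℕ, 1 - a / c * q ^ i ≠ 0) (hq : q ≠ 0) (z : K)
    (k : ℕ) :
    wellPoisedTerm a b (c * q) d q z k * ((1 - c) * (1 - a / c)) =
      wellPoisedTerm a b c d q z k * ((1 - c * q ^ k) * (1 - a / c * q ^ k)) := by
  have h := qShiftedFactorial_mul_div_mul c hc k
  simp only [wellPoisedTerm, mul_div_mul_right a c hq, mul_div_right_comm a q c]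
  linear_combination qShiftedFactorial a q k / qShiftedFactorial q q k *
    (qShiftedFactorial b q k / qShiftedFactorial (a * q / b) q k) *
    (qShiftedFactorial d q k / qShiftedFactorial (a * q / d) q k) * z ^ k * h

/-- A Wilf–Zeilberger certificate for raising the parameter `c` to `c q`. -/
theorem veryWellPoisedTerm_contiguous (ha : 1 - a ≠ 0) (hb₀ : b ≠ 0) (hc₀ : c ≠ 0) (hd₀ : d ≠ 0)
    (hq₀ : q ≠ 0) (hc : ∀ i : ℕ, 1 - a / c * q ^ i ≠ 0) (k : ℕ) :
    (1 - a) * (1 - c) *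
        ((1 - a / (b * c)) * (1 - a / (c * d)) * veryWellPoisedTerm a b c d q k -
          (1 - a / c) * (1 - a / (b * c * d)) * veryWellPoisedTerm a b (c * q) d q k) =
      wellPoisedTerm a b c d q (a / (b * c * d)) k *
          (a / (b * c * d) * (1 - a * q ^ k) * (1 - b * q ^ k) * (1 - c * q ^ k) *
            (1 - d * q ^ k)) -
        wellPoisedTerm a b c d q (a / (b * c * d)) k *
          ((1 - q ^ k) * (1 - a / b * q ^ k) * (1 - a / c * q ^ k) * (1 - a / d * q ^ k)) := by
  have hz : a * q / (b * c * d) = a / (b * c * d) * q := mul_div_right_comm a q (b * c * d)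
  have hz' : a * q / (b * (c * q) * d) = a / (b * c * d) := by field_simp
  have hraise := wellPoisedTerm_mul_base (b := b) (d := d) hc hq₀ (a / (b * c * d)) k
  have hcert : ∀ y : K, (1 - a * y ^ 2) *
      ((1 - c) * (1 - a / (b * c)) * (1 - a / (c * d)) * y -
        (1 - a / (b * c * d)) * ((1 - c * y) * (1 - a / c * y))) =
      a / (b * c * d) * (1 - a * y) * (1 - b * y) * (1 - c * y) * (1 - d * y) -
        (1 - y) * (1 - a / b * y) * (1 - a / c * y) * (1 - a / d * y) := fun y ↦ by
    field_simp
    ring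
  rw [veryWellPoisedTerm, veryWellPoisedTerm, hz, hz', wellPoisedTerm_mul_argument, mul_comm 2 k,
    pow_mul]
  have hpoise : (1 - a) * ((1 - a * (q ^ k) ^ 2) / (1 - a)) = 1 - a * (q ^ k) ^ 2 :=
    mul_div_cancel₀ _ ha
  generalize (1 - a * (q ^ k) ^ 2) / (1 - a) = poise at *
  generalize wellPoisedTerm a b (c * q) d q (a / (b * c * d)) k = raised at *
  generalize wellPoisedTerm a b c d q (a / (b * c * d)) k = term at *
  linear_combination
    ((1 - c) * (1 - a / (b * c)) * (1 - a / (c * d)) * q ^ k * term -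
      (1 - c) * (1 - a / c) * (1 - a / (b * c * d)) * raised) * hpoise -
    (1 - a * (q ^ k) ^ 2) * (1 - a / (b * c * d)) * hraise + term * hcert (q ^ k)

theorem sum_veryWellPoisedTerm_contiguous (ha : 1 - a ≠ 0) (hb₀ : b ≠ 0) (hc₀ : c ≠ 0)
    (hc₁ : 1 - c ≠ 0) (hd₀ : d ≠ 0) (hq₀ : q ≠ 0) (hq : ∀ i : ℕ, 1 - q * q ^ i ≠ 0)
    (hb : ∀ i : ℕ, 1 - a * q / b * q ^ i ≠ 0) (hc : ∀ i : ℕ, 1 - a / c * q ^ i ≠ 0)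
    (hd : ∀ i : ℕ, 1 - a * q / d * q ^ i ≠ 0) {M : ℕ} (hM : qShiftedFactorial c q M = 0) :
    (1 - a / (b * c)) * (1 - a / (c * d)) *
        ∑ k ∈ Finset.range M, veryWellPoisedTerm a b c d q k =
      (1 - a / c) * (1 - a / (b * c * d)) *
        ∑ k ∈ Finset.range M, veryWellPoisedTerm a b (c * q) d q k := by
  let cert (k : ℕ) : K := wellPoisedTerm a b c d q (a / (b * c * d)) k *
    ((1 - q ^ k) * (1 - a / b * q ^ k) * (1 - a / c * q ^ k) * (1 - a / d * q ^ k))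
  have hshift : ∀ x k, a * q / x * q ^ k = a / x * q ^ (k + 1) := fun x k ↦ by
    rw [pow_succ']; ring
  have hcert (k : ℕ) : (1 - a) * (1 - c) *
        ((1 - a / (b * c)) * (1 - a / (c * d)) * veryWellPoisedTerm a b c d q k -
          (1 - a / c) * (1 - a / (b * c * d)) * veryWellPoisedTerm a b (c * q) d q k) =
      cert (k + 1) - cert k := by
    rw [veryWellPoisedTerm_contiguous ha hb₀ hc₀ hd₀ hq₀ hc, ← wellPoisedTerm_succ hq hb
      (fun i ↦ by rw [hshift]; exact hc (i + 1)) hd, ← pow_succ', hshift, hshift, hshift]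
  rw [← sub_eq_zero, Finset.mul_sum, Finset.mul_sum, ← Finset.sum_sub_distrib]
  apply (mul_eq_zero_iff_left (mul_ne_zero ha hc₁)).mp
  rw [Finset.mul_sum, Finset.sum_congr rfl fun k _ ↦ hcert k, Finset.sum_range_sub]
  simp only [cert, wellPoisedTerm_eq_zero hM, pow_zero, sub_self, zero_mul, mul_zero]

/-- The terminating `₆φ₅` summation (Rogers), with `c = q ^ (-m)`. -/
theorem sum_veryWellPoisedTerm (ha : 1 - a ≠ 0) (hb₀ : b ≠ 0) (hd₀ : d ≠ 0) (hq₀ : q ≠ 0)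
    (hq : ∀ i : ℕ, 1 - q * q ^ i ≠ 0) (haq : ∀ i : ℕ, 1 - a * q * q ^ i ≠ 0)
    (hb : ∀ i : ℕ, 1 - a * q / b * q ^ i ≠ 0) (hd : ∀ i : ℕ, 1 - a * q / d * q ^ i ≠ 0)
    {m M : ℕ} (hmM : m < M) :
    (∑ k ∈ Finset.range M, veryWellPoisedTerm a b (q ^ m)⁻¹ d q k) *
        (qShiftedFactorial (a * q / b) q m * qShiftedFactorial (a * q / d) q m) =
      qShiftedFactorial (a * q) q m * qShiftedFactorial (a * q / (b * d)) q m := by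
  induction m with
  | zero =>
    rw [Finset.sum_eq_single_of_mem 0 (Finset.mem_range.mpr hmM) fun k _ hk ↦ by
      rw [veryWellPoisedTerm, wellPoisedTerm_eq_zero
        (qShiftedFactorial_inv_pow_eq_zero hq₀ (Nat.pos_of_ne_zero hk)), mul_zero]]
    simp only [veryWellPoisedTerm, wellPoisedTerm_zero, qShiftedFactorial_zero, mul_zero, pow_zero,
      mul_one, div_self ha]
  | succ m ih =>
    have hpow : q ^ (m + 1) ≠ 0 := pow_ne_zero _ hq₀
    have hc₁ : 1 - (q ^ (m + 1))⁻¹ ≠ 0 := by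
      rw [sub_ne_zero, ne_comm, inv_ne_one, ne_comm, ← sub_ne_zero, pow_succ']
      exact hq m
    have hraise : (q ^ (m + 1))⁻¹ * q = (q ^ m)⁻¹ := by field
    have h := sum_veryWellPoisedTerm_contiguous ha hb₀ (inv_ne_zero hpow) hc₁ hd₀ hq₀ hq hb
      (fun i ↦ by simpa only [div_inv_eq_mul, pow_succ', pow_add, mul_assoc] using haq (m + i)) hd
      (qShiftedFactorial_inv_pow_eq_zero hq₀ hmM)
    rw [hraise] at h
    have e₁ : a / (b * (q ^ (m + 1))⁻¹) = a * q / b * q ^ m := by field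
    have e₂ : a / ((q ^ (m + 1))⁻¹ * d) = a * q / d * q ^ m := by field
    have e₃ : a / (q ^ (m + 1))⁻¹ = a * q * q ^ m := by field
    have e₄ : a / (b * (q ^ (m + 1))⁻¹ * d) = a * q / (b * d) * q ^ m := by field
    rw [e₁, e₂, e₃, e₄] at h
    simp only [qShiftedFactorial_succ]
    linear_combination
      qShiftedFactorial (a * q / b) q m * qShiftedFactorial (a * q / d) q m * h +
      (1 - a * q * q ^ m) * (1 - a * q / (b * d) * q ^ m) * ih (by omega)

end VeryWellPoised

section DeformedSeries

variable {K : Type*} [Field K] {q t : K}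

/-- The summand of `truncatedSum`. -/
def seriesTerm (q : K) (k : ℕ) : K :=
  (1 + q ^ (4 * k + 1)) * qShiftedFactorial (q ^ 2) (q ^ 4) k ^ 3 /
    ((1 + q) * qShiftedFactorial (q ^ 4) (q ^ 4) k ^ 3) * q ^ k

/-- The summand of `truncatedSum` after the "creative microscoping" deformation, which introduces
a parameter `t` into two of the three shifted factorials above and below; `t = 1` gives back
`seriesTerm`. -/
def deformedTerm (t q : K) (k : ℕ) : K :=
  (1 + q ^ (4 * k + 1)) * (qShiftedFactorial (q ^ 2) (q ^ 4) k *
      qShiftedFactorial (t * q ^ 2) (q ^ 4) k * qShiftedFactorial (q ^ 2 / t) (q ^ 4) k) /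
    ((1 + q) * (qShiftedFactorial (q ^ 4) (q ^ 4) k *
      qShiftedFactorial (t * q ^ 4) (q ^ 4) k * qShiftedFactorial (q ^ 4 / t) (q ^ 4) k)) * q ^ k

theorem truncatedSum_eq_sum (q : K) (M : ℕ) :
    truncatedSum q M = ∑ k ∈ Finset.range (M + 1), seriesTerm q k := rfl

theorem ne_zero_of_zpow_injective (hq : Function.Injective fun e : ℤ ↦ q ^ e) : q ≠ 0 := by
  rintro rfl
  exact absurd (hq (by simp : (0 : K) ^ (1 : ℤ) = 0 ^ (2 : ℤ))) (by norm_num)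

theorem one_sub_zpow_ne_zero (hq : Function.Injective fun e : ℤ ↦ q ^ e) {e : ℤ} (he : e ≠ 0) :
    1 - q ^ e ≠ 0 := by
  rw [← zpow_zero q, sub_ne_zero]
  exact hq.ne he.symm

theorem one_sub_pow_ne_zero (hq : Function.Injective fun e : ℤ ↦ q ^ e) {k : ℕ} (hk : k ≠ 0) :
    1 - q ^ k ≠ 0 :=
  mod_cast one_sub_zpow_ne_zero hq (Nat.cast_ne_zero.mpr hk)

theorem qShiftedFactorial_pow_ne_zero (hq : Function.Injective fun e : ℤ ↦ q ^ e) {c : ℕ}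
    (hc : c ≠ 0) (g k : ℕ) : qShiftedFactorial (q ^ c) (q ^ g) k ≠ 0 :=
  qShiftedFactorial_ne_zero (fun i ↦ by
    rw [← pow_mul, ← pow_add]
    exact one_sub_pow_ne_zero hq (by omega)) k

theorem deformedTerm_eq_veryWellPoisedTerm (hq : Function.Injective fun e : ℤ ↦ q ^ e)
    (ht : t ≠ 0) (k : ℕ) :
    deformedTerm t q k = veryWellPoisedTerm (q ^ 2) q (q ^ 2 / t) (t * q ^ 2) (q ^ 4) k := by
  have hq₀ := ne_zero_of_zpow_injective hq
  have hq₂ : 1 - q ^ 2 ≠ 0 := one_sub_pow_ne_zero hq two_ne_zero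
  have hq₂' : 1 + q ≠ 0 := fun h ↦ hq₂ (by linear_combination (1 - q) * h)
  have hnum := one_sub_mul_qShiftedFactorial_mul q (q ^ 4) k
  have hpoise : (1 - q ^ 2 * (q ^ 4) ^ (2 * k)) / (1 - q ^ 2) *
      (qShiftedFactorial q (q ^ 4) k / qShiftedFactorial (q ^ 2 * q ^ 4 / q) (q ^ 4) k) =
      (1 + q ^ (4 * k + 1)) / (1 + q) := by
    have hden : qShiftedFactorial (q * q ^ 4) (q ^ 4) k ≠ 0 := by
      simpa only [← pow_succ'] using qShiftedFactorial_pow_ne_zero hq (c := 5) (by norm_num) 4 k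
    rw [show q ^ 2 * q ^ 4 / q = q * q ^ 4 by field, div_mul_div_comm,
      div_eq_div_iff (mul_ne_zero hq₂ hden) hq₂']
    linear_combination -(1 + q ^ (4 * k + 1)) * (1 + q) * hnum
  rw [deformedTerm, veryWellPoisedTerm, wellPoisedTerm,
    show q ^ 2 * q ^ 4 / (q ^ 2 / t) = t * q ^ 4 by field,
    show q ^ 2 * q ^ 4 / (t * q ^ 2) = q ^ 4 / t by field,
    show q ^ 2 * q ^ 4 / (q * (q ^ 2 / t) * (t * q ^ 2)) = q by field,
    mul_div_mul_comm, ← hpoise]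
  simp only [div_eq_mul_inv, mul_inv]
  ring

theorem sum_deformedTerm_mul (hq : Function.Injective fun e : ℤ ↦ q ^ e) {m M : ℕ} (hmM : m < M) :
    (∑ k ∈ Finset.range M, deformedTerm (q ^ (2 * (2 * m + 1))) q k) *
        (qShiftedFactorial (q ^ 5) (q ^ 4) m *
          qShiftedFactorial (q ^ 4 / (q ^ 2 * (q ^ 4) ^ m)) (q ^ 4) m) =
      qShiftedFactorial (q ^ 2 * q ^ 4) (q ^ 4) m *
        qShiftedFactorial (q ^ 4 / (q ^ 3 * (q ^ 4) ^ m)) (q ^ 4) m := by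
  have hq₀ := ne_zero_of_zpow_injective hq
  have hne {a : K} (e : ℤ) (ha : a = q ^ e) (he : ¬ (4 : ℤ) ∣ e ∨ 0 < e) (i : ℕ) :
      1 - a * (q ^ 4) ^ i ≠ 0 := by
    rw [ha, ← pow_mul, ← zpow_natCast, ← zpow_add₀ hq₀]
    exact one_sub_zpow_ne_zero hq (by omega)
  have hb : q ^ 2 * q ^ 4 / q = q ^ 5 := by field
  have hd : q ^ 2 * q ^ 4 / (q ^ (2 * (2 * m + 1)) * q ^ 2) = q ^ 4 / (q ^ 2 * (q ^ 4) ^ m) := by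
    field
  have hbd : q ^ 2 * q ^ 4 / (q * (q ^ (2 * (2 * m + 1)) * q ^ 2)) =
      q ^ 4 / (q ^ 3 * (q ^ 4) ^ m) := by
    field
  have hd' : q ^ 4 / (q ^ 2 * (q ^ 4) ^ m) = q ^ (2 - 4 * m : ℤ) := by
    rw [zpow_sub₀ hq₀, zpow_mul, zpow_natCast]
    norm_cast
    field
  have hc : q ^ 2 / q ^ (2 * (2 * m + 1)) = ((q ^ 4) ^ m)⁻¹ := by field
  have hsum := sum_veryWellPoisedTerm (a := q ^ 2) (b := q) (d := q ^ (2 * (2 * m + 1)) * q ^ 2)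
    (one_sub_pow_ne_zero hq two_ne_zero) hq₀ (by positivity) (pow_ne_zero 4 hq₀)
    (hne 4 (by norm_cast) (by omega)) (hne 6 (by norm_cast; ring) (by omega))
    (hne 5 (by rw [hb]; norm_cast) (by omega)) (hne (2 - 4 * m) (by rw [hd, hd']) (by omega)) hmM
  rw [hb, hd, hbd] at hsum
  rw [← hsum]
  simp only [deformedTerm_eq_veryWellPoisedTerm hq (pow_ne_zero (2 * (2 * m + 1)) hq₀), hc]

theorem sum_deformedTerm (hq : Function.Injective fun e : ℤ ↦ q ^ e) {m M : ℕ} (hmM : m < M) :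
    ∑ k ∈ Finset.range M, deformedTerm (q ^ (2 * (2 * m + 1))) q k = closedForm q (2 * m + 1) := by
  have hq₀ := ne_zero_of_zpow_injective hq
  have hp₀ : q ^ 4 ≠ 0 := pow_ne_zero 4 hq₀
  have hsum := sum_deformedTerm_mul hq hmM
  have hfirst := one_sub_mul_qShiftedFactorial_mul (q ^ 2) (q ^ 4) m
  have hreflect := qShiftedFactorial_reflect_mul (pow_ne_zero 3 hq₀) (pow_ne_zero 2 hq₀) hp₀ m
  have hint := qInteger_mul_one_sub (q ^ 2) (2 * m + 1)
  have h₂ : qShiftedFactorial (q ^ 4 / (q ^ 2 * (q ^ 4) ^ m)) (q ^ 4) m ≠ 0 :=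
    left_ne_zero_of_mul <| qShiftedFactorial_reflect (pow_ne_zero 2 hq₀) hp₀ m ▸
      qShiftedFactorial_pow_ne_zero hq two_ne_zero 4 m
  have h₅ : qShiftedFactorial (q ^ 5) (q ^ 4) m ≠ 0 :=
    qShiftedFactorial_pow_ne_zero hq (by norm_num) 4 m
  rw [closedForm, show (2 * m + 1 - 1) / 2 = m by omega,
    show (1 - ((2 * m + 1 : ℕ) : ℤ)) / 2 = -m by omega, zpow_neg, zpow_natCast, ← div_eq_mul_inv,
    div_div, eq_div_iff (by positivity)]
  apply mul_left_cancel₀ (mul_ne_zero (mul_ne_zero h₂ (one_sub_pow_ne_zero hq two_ne_zero))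
    (pow_ne_zero m (pow_ne_zero 2 hq₀)))
  generalize qShiftedFactorial (q ^ 4 / (q ^ 2 * (q ^ 4) ^ m)) (q ^ 4) m = A at *
  generalize qShiftedFactorial (q ^ 4 / (q ^ 3 * (q ^ 4) ^ m)) (q ^ 4) m = B at *
  linear_combination (1 - q ^ 2) * q ^ (3 * m) * hsum + q ^ (3 * m) * B * hfirst +
    (1 - q ^ 2 * (q ^ 4) ^ m) * hreflect -
    A * qShiftedFactorial (q ^ 3) (q ^ 4) m * (q ^ 2) ^ m * hint

end DeformedSeries

section Deformation

variable {K : Type*} [Field K] {q t : K}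

/-- The relative change of `(1 - y) ^ 2` when one factor `y` is replaced by `t y` and the other by
`y / t`. -/
def deformationFactor (t y : K) : K :=
  (1 - t * y) * (1 - y / t) / (1 - y) ^ 2

/-- The quotient of `deformedTerm t q k` by `seriesTerm q k`. -/
def deformationRatio (t q : K) (k : ℕ) : K :=
  ∏ i ∈ Finset.range k,
    deformationFactor t (q ^ (4 * i + 2)) / deformationFactor t (q ^ (4 * i + 4))

theorem deformationRatio_zero (t q : K) : deformationRatio t q 0 = 1 :=
  Finset.prod_range_zero _

theorem deformationRatio_succ (t q : K) (k : ℕ) :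
    deformationRatio t q (k + 1) = deformationRatio t q k *
      (deformationFactor t (q ^ (4 * k + 2)) / deformationFactor t (q ^ (4 * k + 4))) :=
  Finset.prod_range_succ _ _

theorem prod_deformationFactor (t q : K) (c k : ℕ) :
    ∏ i ∈ Finset.range k, deformationFactor t (q ^ (4 * i + c)) =
      qShiftedFactorial (t * q ^ c) (q ^ 4) k * qShiftedFactorial (q ^ c / t) (q ^ 4) k /
        qShiftedFactorial (q ^ c) (q ^ 4) k ^ 2 := by
  simp only [deformationFactor, qShiftedFactorial, Finset.prod_div_distrib, Finset.prod_mul_distrib,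
    Finset.prod_pow, ← pow_mul, mul_assoc, div_mul_eq_mul_div, ← pow_add, add_comm c]

theorem deformedTerm_eq_seriesTerm_mul (hq : Function.Injective fun e : ℤ ↦ q ^ e) (t : K)
    (k : ℕ) : deformedTerm t q k = seriesTerm q k * deformationRatio t q k := by
  have h₂ := qShiftedFactorial_pow_ne_zero hq two_ne_zero 4 k
  have h₄ := qShiftedFactorial_pow_ne_zero hq four_ne_zero 4 k
  rw [deformedTerm, seriesTerm, deformationRatio, Finset.prod_div_distrib,
    prod_deformationFactor, prod_deformationFactor]
  field

theorem deformationFactor_sub_one {y : K} (ht : t ≠ 0) (hy : 1 - y ≠ 0) :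
    deformationFactor t y - 1 = -(y * (1 - t) ^ 2 / (t * (1 - y) ^ 2)) := by
  rw [deformationFactor]
  field

end Deformation

section CyclotomicValuation

theorem not_dvd_two_mul_mul_add {d : ℕ} (hd : Odd d) {c : ℕ} (hc : c ≠ 0) (hcd : c < d) (a : ℕ) :
    ¬ d ∣ 2 * (a * d + c) := by
  rw [(Nat.coprime_two_right.mpr hd).dvd_mul_left, ← Nat.dvd_add_iff_right (dvd_mul_left d a)]
  exact Nat.not_dvd_of_pos_of_lt (Nat.pos_of_ne_zero hc) hcd

variable {K Γ₀ : Type*} [Field K] [LinearOrderedCommGroupWithZero Γ₀]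

/-- A valuation that behaves on the elements `1 - q ^ e` like the `Φ_d(q)`-adic valuation, with
`Φ_d(q)` of value `π`. Congruences modulo `Φ_d(q) ^ 2` become bounds by `π ^ 2`. -/
structure IsCyclotomicValuation (v : Valuation K Γ₀) (q : K) (d : ℕ) (π : Γ₀) : Prop where
  map_base : v q = 1
  map_one_sub_zpow : ∀ e : ℤ, e ≠ 0 → v (1 - q ^ e) = if (d : ℤ) ∣ e then π else 1
  ne_zero : π ≠ 0
  lt_one : π < 1

namespace IsCyclotomicValuation

variable {v : Valuation K Γ₀} {q : K} {d : ℕ} {π : Γ₀}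

theorem base_ne_zero (h : IsCyclotomicValuation v q d π) : q ≠ 0 :=
  v.ne_zero_iff.mp (h.map_base ▸ one_ne_zero)

theorem zpow_injective (h : IsCyclotomicValuation v q d π) :
    Function.Injective fun e : ℤ ↦ q ^ e := by
  intro e f hef
  by_contra hne
  have hone : q ^ (e - f) = 1 := by
    rw [zpow_sub₀ h.base_ne_zero, div_eq_one_iff_eq (zpow_ne_zero f h.base_ne_zero)]
    exact hef
  have hv := h.map_one_sub_zpow (e - f) (sub_ne_zero.mpr hne)
  rw [hone, sub_self, map_zero] at hv
  split_ifs at hv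
  exacts [h.ne_zero hv.symm, zero_ne_one hv]

theorem map_one_sub_pow (h : IsCyclotomicValuation v q d π) {k : ℕ} (hk : k ≠ 0) :
    v (1 - q ^ k) = if d ∣ k then π else 1 := by
  simpa only [zpow_natCast, Int.natCast_dvd_natCast] using
    h.map_one_sub_zpow k (Nat.cast_ne_zero.mpr hk)

theorem map_one_sub_pow_le (h : IsCyclotomicValuation v q d π) {k : ℕ} (hk : d ∣ k) :
    v (1 - q ^ k) ≤ π := by
  rcases eq_or_ne k 0 with rfl | hk₀
  · simp
  · rw [h.map_one_sub_pow hk₀, if_pos hk]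

theorem map_one_add_pow (h : IsCyclotomicValuation v q d π) (hd : Odd d) {k : ℕ} (hk : k ≠ 0) :
    v (1 + q ^ k) = 1 := by
  have hmul : v (1 + q ^ k) * v (1 - q ^ k) = v (1 - q ^ (2 * k)) := by
    rw [← map_mul]
    ring_nf
  rw [h.map_one_sub_pow hk, h.map_one_sub_pow (mul_ne_zero two_ne_zero hk)] at hmul
  simp only [(Nat.coprime_two_right.mpr hd).dvd_mul_left] at hmul
  split_ifs at hmul
  · exact mul_right_cancel₀ h.ne_zero (hmul.trans (one_mul π).symm)
  · simpa only [mul_one] using hmul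

theorem map_qShiftedFactorial (h : IsCyclotomicValuation v q d π) {g c j : ℕ} (hg : d.Coprime g)
    (hc : c ≠ 0) (hj : d ∣ c + g * j) (k : ℕ) :
    v (qShiftedFactorial (q ^ c) (q ^ g) k) = π ^ (k / d + if j % d < k % d then 1 else 0) := by
  have hd : 0 < d := Nat.pos_of_dvd_of_pos hj (by omega)
  have hdvd (i : ℕ) : d ∣ c + g * i ↔ i ≡ j [MOD d] := by
    rw [← Nat.modEq_zero_iff_dvd] at hj ⊢
    exact ⟨fun hi ↦ ((hi.trans hj.symm).add_left_cancel' c).cancel_left_of_coprime hg,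
      fun hi ↦ ((hi.mul_left g).add_left c).trans hj⟩
  have hfactor (i : ℕ) : v (1 - q ^ c * (q ^ g) ^ i) = if i ≡ j [MOD d] then π else 1 := by
    rw [← pow_mul, ← pow_add, h.map_one_sub_pow (by omega), if_congr (hdvd i) rfl rfl]
  rw [qShiftedFactorial, map_prod, Finset.prod_congr rfl fun i _ ↦ hfactor i, Finset.prod_ite,
    Finset.prod_const, Finset.prod_const_one, mul_one, ← Nat.count_eq_card_filter_range,
    Nat.count_modEq_card k hd]

theorem map_seriesTerm (h : IsCyclotomicValuation v q d π) (hd : Odd d) (k : ℕ) :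
    v (seriesTerm q k) = if (d - 1) / 2 < k % d then π ^ 3 else 1 := by
  have hpos := hd.pos
  have hcop : d.Coprime 4 := (Nat.coprime_two_right.mpr hd).pow_right 2
  have hmod := Nat.mod_lt k hpos
  have h₂ := h.map_qShiftedFactorial (j := (d - 1) / 2) hcop two_ne_zero
    ⟨2, by have := Nat.odd_iff.mp hd; omega⟩ k
  have h₄ := h.map_qShiftedFactorial (j := d - 1) hcop four_ne_zero ⟨4, by omega⟩ k
  rw [Nat.mod_eq_of_lt (by omega)] at h₂ h₄
  rw [if_neg (by omega), add_zero] at h₄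
  have hnum := h.map_one_add_pow hd (k := 4 * k + 1) (by omega)
  have hden : v (1 + q) = 1 := by simpa only [pow_one] using h.map_one_add_pow hd one_ne_zero
  have hπ : π ^ (k / d) ≠ 0 := pow_ne_zero _ h.ne_zero
  simp only [seriesTerm, map_mul, map_div₀, map_pow, hnum, hden, h₂, h₄, h.map_base, one_pow,
    one_mul, mul_one]
  split_ifs
  · rw [pow_succ π, mul_pow, mul_div_cancel_left₀ _ (pow_ne_zero 3 hπ)]
  · rw [add_zero, div_self (pow_ne_zero 3 hπ)]

theorem map_seriesTerm_le_one (h : IsCyclotomicValuation v q d π) (hd : Odd d) (k : ℕ) :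
    v (seriesTerm q k) ≤ 1 := by
  rw [h.map_seriesTerm hd]
  split_ifs
  exacts [pow_le_one' h.lt_one.le 3, le_rfl]

theorem map_seriesTerm_le_sq (h : IsCyclotomicValuation v q d π) (hd : Odd d) {k : ℕ}
    (hk : (d - 1) / 2 < k % d) : v (seriesTerm q k) ≤ π ^ 2 := by
  rw [h.map_seriesTerm hd, if_pos hk]
  exact pow_le_pow_right_of_le_one' h.lt_one.le (by norm_num)

/-- The quotient of shifted factorials contributes one of the two factors `π`: the residue class
`j ≡ -3 / 4` modulo `d` is met once more than `j ≡ -5 / 4` below `(d (2 s + 1) - 1) / 2`. -/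
theorem map_closedForm (h : IsCyclotomicValuation v q d π) (hd : d % 4 = 3) (s : ℕ) :
    v (closedForm q (d * (2 * s + 1))) = π ^ 2 := by
  have hodd : Odd d := Nat.odd_iff.mpr (by omega)
  have hcop : d.Coprime 4 := (Nat.coprime_two_right.mpr hodd).pow_right 2
  have hhalf : (d * (2 * s + 1) - 1) / 2 = (d - 1) / 2 + d * s := by
    rw [mul_add, mul_left_comm]
    omega
  have hmod : ((d - 1) / 2 + d * s) % d = (d - 1) / 2 := by
    rw [Nat.add_mul_mod_self_left, Nat.mod_eq_of_lt (by omega)]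
  have h₃ := h.map_qShiftedFactorial (c := 3) (j := (d - 3) / 4) hcop three_ne_zero
    ⟨1, by omega⟩ ((d - 1) / 2 + d * s)
  have h₅ := h.map_qShiftedFactorial (c := 5) (j := (3 * d - 5) / 4) hcop (by norm_num)
    ⟨3, by omega⟩ ((d - 1) / 2 + d * s)
  rw [hmod, Nat.mod_eq_of_lt (by omega)] at h₃ h₅
  rw [if_pos (by omega)] at h₃
  rw [if_neg (by omega), add_zero] at h₅
  have hint : v (qInteger (q ^ 2) (d * (2 * s + 1))) = π := by
    have hmul := congrArg v (qInteger_mul_one_sub (q ^ 2) (d * (2 * s + 1)))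
    rw [map_mul, ← pow_mul, h.map_one_sub_pow two_ne_zero,
      if_neg fun hdvd ↦ by have := Nat.le_of_dvd two_pos hdvd; omega, mul_one,
      h.map_one_sub_pow (by have := hodd.pos; positivity),
      if_pos (dvd_mul_of_dvd_right (dvd_mul_right d _) 2)] at hmul
    exact hmul
  rw [closedForm, hhalf, map_mul, map_div₀, map_mul, map_zpow₀, hint, h.map_base, one_zpow, h₃, h₅,
    pow_succ, mul_left_comm, mul_one, mul_div_cancel_left₀ _ (pow_ne_zero _ h.ne_zero), sq]

theorem map_deformationFactor (h : IsCyclotomicValuation v q d π) {N e : ℕ} (hN : d ∣ N)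
    (he : e ≠ 0) (heN : e ≠ N) : v (deformationFactor (q ^ N) (q ^ e)) = 1 := by
  have hmul : 1 - q ^ N * q ^ e = 1 - q ^ ((e : ℤ) + N) := by
    rw [add_comm, zpow_add₀ h.base_ne_zero, zpow_natCast, zpow_natCast]
  have hdiv : 1 - q ^ e / q ^ N = 1 - q ^ ((e : ℤ) - N) := by
    rw [zpow_sub₀ h.base_ne_zero, zpow_natCast, zpow_natCast]
  have hN' : (d : ℤ) ∣ N := Int.natCast_dvd_natCast.mpr hN
  rw [deformationFactor, map_div₀, map_mul, map_pow, hmul, hdiv, h.map_one_sub_zpow _ (by omega),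
    h.map_one_sub_zpow _ (by omega), h.map_one_sub_pow he]
  simp only [dvd_add_left hN', dvd_sub_left hN', Int.natCast_dvd_natCast]
  split_ifs
  · rw [← sq, div_self (pow_ne_zero 2 h.ne_zero)]
  · simp only [one_pow, mul_one, div_one]

theorem map_deformationFactor_le_one (h : IsCyclotomicValuation v q d π) {N e : ℕ} (hN : d ∣ N)
    (he : e ≠ 0) : v (deformationFactor (q ^ N) (q ^ e)) ≤ 1 := by
  rcases eq_or_ne e N with rfl | heN
  · rw [deformationFactor, div_self (pow_ne_zero e h.base_ne_zero), sub_self, mul_zero, zero_div,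
      map_zero]
    exact zero_le
  · exact (h.map_deformationFactor hN he heN).le

theorem map_deformationFactor_sub_one_le (h : IsCyclotomicValuation v q d π) {N e : ℕ} (hN : d ∣ N)
    (he : ¬ d ∣ e) : v (deformationFactor (q ^ N) (q ^ e) - 1) ≤ π ^ 2 := by
  have he₀ : e ≠ 0 := fun h₀ ↦ he (h₀ ▸ dvd_zero d)
  rw [deformationFactor_sub_one (pow_ne_zero N h.base_ne_zero)
    (one_sub_pow_ne_zero h.zpow_injective he₀)]
  simp only [Valuation.map_neg, map_div₀, map_mul, map_pow, h.map_base, h.map_one_sub_pow he₀,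
    if_neg he, one_pow, one_mul, div_one]
  exact pow_le_pow_left' (h.map_one_sub_pow_le hN) 2

theorem map_deformationFactor_div_sub_one_le (h : IsCyclotomicValuation v q d π) {N e f : ℕ}
    (hN : d ∣ N) (he : ¬ d ∣ e) (hf : ¬ d ∣ f) :
    v (deformationFactor (q ^ N) (q ^ e) / deformationFactor (q ^ N) (q ^ f) - 1) ≤ π ^ 2 := by
  have hval : v (deformationFactor (q ^ N) (q ^ f)) = 1 :=
    h.map_deformationFactor hN (fun h₀ ↦ hf (h₀ ▸ dvd_zero d)) fun hfN ↦ hf (hfN ▸ hN)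
  have hne : deformationFactor (q ^ N) (q ^ f) ≠ 0 := v.ne_zero_iff.mp (hval ▸ one_ne_zero)
  rw [div_sub_one hne, map_div₀, hval, div_one, ← sub_sub_sub_cancel_right _ _ 1]
  exact v.map_sub_le (h.map_deformationFactor_sub_one_le hN he)
    (h.map_deformationFactor_sub_one_le hN hf)

theorem map_deformationRatio_le_one (h : IsCyclotomicValuation v q d π) {N : ℕ} (hN : d ∣ N)
    (hN₄ : ¬ 4 ∣ N) (k : ℕ) : v (deformationRatio (q ^ N) q k) ≤ 1 := by
  rw [deformationRatio, map_prod]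
  refine Finset.prod_le_one' fun i _ ↦ ?_
  rw [map_div₀, h.map_deformationFactor (e := 4 * i + 4) hN (by omega) (by omega), div_one]
  exact h.map_deformationFactor_le_one hN (by omega)

theorem map_deformationRatio (h : IsCyclotomicValuation v q d π) {N : ℕ} (hN : d ∣ N)
    (hN₄ : ¬ 4 ∣ N) {k : ℕ} (hk : 4 * k ≤ N) : v (deformationRatio (q ^ N) q k) = 1 := by
  rw [deformationRatio, map_prod]
  refine Finset.prod_eq_one fun i hi ↦ ?_
  have hik := Finset.mem_range.mp hi
  rw [map_div₀, h.map_deformationFactor hN (by omega) (by omega),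
    h.map_deformationFactor hN (by omega) (by omega), div_one]

/-- Inside the first half of a block no exponent `4 i + 2` or `4 i + 4` is divisible by `d`, so the
ratio stays constant to second order. -/
theorem map_deformationRatio_sub_le (h : IsCyclotomicValuation v q d π) (hd : Odd d) {N : ℕ}
    (hN : d ∣ N) (hN₄ : ¬ 4 ∣ N) (a : ℕ) {b : ℕ} (hb : b ≤ (d - 1) / 2) :
    v (deformationRatio (q ^ N) q (a * d + b) - deformationRatio (q ^ N) q (a * d)) ≤ π ^ 2 := by
  induction b with
  | zero => simp
  | succ b ih =>
    have h₂ : ¬ d ∣ 4 * (a * d + b) + 2 := by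
      rw [show 4 * (a * d + b) + 2 = 2 * (2 * a * d + (2 * b + 1)) by ring]
      exact not_dvd_two_mul_mul_add hd (by omega) (by omega) (2 * a)
    have h₄ : ¬ d ∣ 4 * (a * d + b) + 4 := by
      rw [show 4 * (a * d + b) + 4 = 2 * (2 * a * d + (2 * b + 2)) by ring]
      exact not_dvd_two_mul_mul_add hd (by omega) (by omega) (2 * a)
    rw [← add_assoc, deformationRatio_succ,
      ← sub_add_sub_cancel _ (deformationRatio _ q (a * d + b)), ← mul_sub_one]
    refine v.map_add_le ?_ (ih (by omega))
    rw [map_mul]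
    exact mul_le_of_le_one_of_le (h.map_deformationRatio_le_one hN hN₄ _)
      (h.map_deformationFactor_div_sub_one_le hN h₂ h₄)

theorem map_deformedTerm_sub_le (h : IsCyclotomicValuation v q d π) (hd : Odd d) {N : ℕ}
    (hN : d ∣ N) (hN₄ : ¬ 4 ∣ N) (a : ℕ) {b : ℕ} (hb : b < d) :
    v (deformedTerm (q ^ N) q (a * d + b) -
      deformationRatio (q ^ N) q (a * d) * seriesTerm q (a * d + b)) ≤ π ^ 2 := by
  rw [deformedTerm_eq_seriesTerm_mul h.zpow_injective, mul_comm (deformationRatio _ _ _),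
    ← mul_sub, map_mul]
  rcases le_or_gt b ((d - 1) / 2) with hhalf | hhalf
  · exact mul_le_of_le_one_of_le (h.map_seriesTerm_le_one hd _)
      (h.map_deformationRatio_sub_le hd hN hN₄ a hhalf)
  · refine mul_le_of_le_of_le_one (h.map_seriesTerm_le_sq hd ?_) (v.map_sub_le
      (h.map_deformationRatio_le_one hN hN₄ _) (h.map_deformationRatio_le_one hN hN₄ _))
    rwa [Nat.mul_add_mod', Nat.mod_eq_of_lt hb]

end IsCyclotomicValuation

end CyclotomicValuation

section Blocks

variable {K Γ₀ : Type*} [Field K] [LinearOrderedCommGroupWithZero Γ₀]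

theorem sum_range_mul_eq_sum_sum {M : Type*} [AddCommMonoid M] (f : ℕ → M) (a d : ℕ) :
    ∑ k ∈ Finset.range (a * d), f k =
      ∑ i ∈ Finset.range a, ∑ j ∈ Finset.range d, f (i * d + j) := by
  induction a with
  | zero => simp
  | succ a ih => rw [add_mul, one_mul, Finset.sum_range_add, ih, Finset.sum_range_succ]

/-- The sum of the `a`-th block of `d` consecutive summands of `truncatedSum`. -/
def blockSum (q : K) (d a : ℕ) : K :=
  ∑ b ∈ Finset.range d, seriesTerm q (a * d + b)

theorem sum_seriesTerm_eq_sum_blockSum (q : K) (d a : ℕ) :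
    ∑ k ∈ Finset.range (a * d), seriesTerm q k = ∑ i ∈ Finset.range a, blockSum q d i :=
  sum_range_mul_eq_sum_sum _ a d

namespace IsCyclotomicValuation

variable {v : Valuation K Γ₀} {q : K} {d : ℕ} {π : Γ₀}

theorem map_sum_deformationRatio_mul_blockSum_sub_closedForm_le
    (h : IsCyclotomicValuation v q d π) (hd : Odd d) (s : ℕ) :
    v (∑ a ∈ Finset.range (s + 1),
        deformationRatio (q ^ (2 * (d * (2 * s + 1)))) q (a * d) * blockSum q d a -
      closedForm q (d * (2 * s + 1))) ≤ π ^ 2 := by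
  have hodd : Odd (d * (2 * s + 1)) := hd.mul (odd_two_mul_add_one s)
  have hdvd : d ∣ 2 * (d * (2 * s + 1)) := dvd_mul_of_dvd_right (dvd_mul_right d _) 2
  have hfour : ¬ 4 ∣ 2 * (d * (2 * s + 1)) := by
    have := Nat.odd_iff.mp hodd
    omega
  have hsum : ∑ k ∈ Finset.range ((s + 1) * d),
      deformedTerm (q ^ (2 * (d * (2 * s + 1)))) q k = closedForm q (d * (2 * s + 1)) := by
    obtain ⟨m, hm⟩ := hodd
    rw [hm]
    exact sum_deformedTerm h.zpow_injective (by have := hd.pos; nlinarith)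
  rw [← hsum, sum_range_mul_eq_sum_sum, ← Finset.sum_sub_distrib]
  refine v.map_sum_le fun a _ ↦ ?_
  rw [blockSum, Finset.mul_sum, ← Finset.sum_sub_distrib]
  refine v.map_sum_le fun b hb ↦ ?_
  rw [Valuation.map_sub_swap]
  exact h.map_deformedTerm_sub_le hd hdvd hfour a (Finset.mem_range.mp hb)

/-- The deformation at `N = d (2 a + 1)` expresses the `a`-th block sum through the earlier
ones. -/
theorem map_blockSum_le (h : IsCyclotomicValuation v q d π) (hd : d % 4 = 3) (a : ℕ) :
    v (blockSum q d a) ≤ π ^ 2 := by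
  have hodd : Odd d := Nat.odd_iff.mpr (by omega)
  induction a using Nat.strong_induction_on with
  | _ a ih =>
    have hratio {i : ℕ} (hi : i ≤ a) :
        v (deformationRatio (q ^ (2 * (d * (2 * a + 1)))) q (i * d)) = 1 :=
      h.map_deformationRatio (dvd_mul_of_dvd_right (dvd_mul_right d _) 2)
        (by have := Nat.odd_iff.mp (hodd.mul (odd_two_mul_add_one a)); omega) (by nlinarith)
    have htotal := v.map_add_le
      (h.map_sum_deformationRatio_mul_blockSum_sub_closedForm_le hodd a) (h.map_closedForm hd a).le
    rw [sub_add_cancel, Finset.sum_range_succ] at htotal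
    have hearlier : v (∑ i ∈ Finset.range a,
        deformationRatio (q ^ (2 * (d * (2 * a + 1)))) q (i * d) * blockSum q d i) ≤ π ^ 2 :=
      v.map_sum_le fun i hi ↦ by
        have hia := Finset.mem_range.mp hi
        rw [map_mul, hratio hia.le, one_mul]
        exact ih i hia
    simpa only [add_sub_cancel_left, map_mul, hratio le_rfl, one_mul] using
      v.map_sub_le htotal hearlier

theorem map_sum_blockSum_sub_closedForm_le (h : IsCyclotomicValuation v q d π) (hd : Odd d)
    {s a : ℕ} (hs : (s = 0 ∧ a = 0) ∨ d % 4 = 3) :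
    v (∑ i ∈ Finset.range (a + 1), blockSum q d i - closedForm q (d * (2 * s + 1))) ≤ π ^ 2 := by
  rcases hs with ⟨rfl, rfl⟩ | hd₃
  · simpa only [Finset.sum_range_succ, Finset.sum_range_zero, zero_mul, deformationRatio_zero,
      one_mul] using h.map_sum_deformationRatio_mul_blockSum_sub_closedForm_le hd 0
  · exact v.map_sub_le (v.map_sum_le fun i _ ↦ h.map_blockSum_le hd₃ i) (h.map_closedForm hd₃ s).le

theorem map_sum_seriesTerm_sub_sum_blockSum_le (h : IsCyclotomicValuation v q d π) (hd : Odd d)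
    (a : ℕ) {c : ℕ} (hc : (d - 1) / 2 < c) (hcd : c ≤ d) :
    v (∑ k ∈ Finset.range (a * d + c), seriesTerm q k -
      ∑ i ∈ Finset.range (a + 1), blockSum q d i) ≤ π ^ 2 := by
  rw [Finset.sum_range_add, sum_seriesTerm_eq_sum_blockSum, Finset.sum_range_succ, blockSum,
    add_sub_add_left_eq_sub, ← Finset.sum_range_add_sum_Ico _ hcd, sub_add_cancel_left,
    Valuation.map_neg]
  refine v.map_sum_le fun b hb ↦ h.map_seriesTerm_le_sq hd ?_
  rw [Finset.mem_Ico] at hb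
  rw [Nat.mul_add_mod', Nat.mod_eq_of_lt hb.2]
  exact hc.trans_le hb.1

theorem map_truncatedSum_sub_closedForm_le (h : IsCyclotomicValuation v q d π) {N M : ℕ}
    (hN : Odd N) (hdN : d ∣ N) (hd : d = N ∨ d % 4 = 3) (hM : M = (N - 1) / 2 ∨ M = N - 1) :
    v (truncatedSum q M - closedForm q N) ≤ π ^ 2 := by
  have hodd : Odd d := hN.of_dvd_nat hdN
  have hpos := hodd.pos
  obtain ⟨e, rfl⟩ := hdN
  obtain ⟨s, rfl⟩ : Odd e := (Nat.odd_mul.mp hN).2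
  have hs : s = 0 ∨ d % 4 = 3 := hd.imp_left fun hself ↦ by nlinarith
  obtain ⟨a, c, ha, hMac, hc, hcd⟩ : ∃ a c, ((s = 0 ∧ a = 0) ∨ d % 4 = 3) ∧ M + 1 = a * d + c ∧
      (d - 1) / 2 < c ∧ c ≤ d := by
    have hmul : d * (2 * s + 1) = 2 * (s * d) + d := by ring
    have := Nat.odd_iff.mp hodd
    rcases hM with rfl | rfl
    · exact ⟨s, (d - 1) / 2 + 1, by omega, by omega, by omega, by omega⟩
    · exact ⟨2 * s, d, by omega, by rw [mul_assoc]; omega, by omega, le_rfl⟩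
  rw [truncatedSum_eq_sum, hMac]
  simpa only [sub_add_sub_cancel] using v.map_add_le
    (h.map_sum_seriesTerm_sub_sum_blockSum_le hodd a hc hcd)
    (h.map_sum_blockSum_sub_closedForm_le hodd ha)

end IsCyclotomicValuation

end Blocks

section AdicValuation

open IsDedekindDomain WithZero

variable {F : Type*} [Field F] {p : F[X]} (hp : Irreducible p)

/-- The `p`-adic valuation of the field of rational functions, for an irreducible polynomial
`p`. -/
noncomputable def adicValuation : Valuation (RatFunc F) ℤᵐ⁰ :=
  (HeightOneSpectrum.ofPrime (Ideal.prime_span_singleton_iff.mpr hp.prime)).valuation (RatFunc F)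

theorem adicValuation_eq_one_iff {f : F[X]} :
    adicValuation hp (algebraMap _ _ f) = 1 ↔ ¬ p ∣ f := by
  rw [adicValuation, HeightOneSpectrum.valuation_eq_one_iff_notMem,
    HeightOneSpectrum.ofPrime_asIdeal, Ideal.mem_span_singleton]

theorem adicValuation_self : adicValuation hp (algebraMap _ _ p) = exp (-1) := by
  rw [adicValuation, HeightOneSpectrum.valuation_of_algebraMap,
    HeightOneSpectrum.intValuation_singleton _ hp.ne_zero rfl]

theorem pow_dvd_num_of_adicValuation_le {x : RatFunc F} {k : ℕ}
    (h : adicValuation hp x ≤ exp (-k : ℤ)) : p ^ k ∣ x.num := by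
  have hmul : algebraMap _ _ x.num = x * algebraMap _ _ x.denom :=
    (div_eq_iff (RatFunc.algebraMap_ne_zero x.denom_ne_zero)).mp x.num_div_denom
  have hnum : adicValuation hp (algebraMap _ _ x.num) ≤ exp (-k : ℤ) := by
    rw [hmul, map_mul]
    exact mul_le_of_le_of_le_one h (HeightOneSpectrum.valuation_le_one _ _)
  rwa [adicValuation, HeightOneSpectrum.valuation_of_algebraMap,
    HeightOneSpectrum.intValuation_le_pow_iff_dvd, HeightOneSpectrum.ofPrime_asIdeal,
    Ideal.span_singleton_pow, Ideal.dvd_span_singleton, Ideal.mem_span_singleton] at hnum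

end AdicValuation

section Cyclotomic

open WithZero

variable {d : ℕ} (hd : 0 < d)

theorem adicValuation_cyclotomic (c : ℕ) :
    adicValuation (cyclotomic.irreducible_rat hd) (algebraMap _ _ (cyclotomic c ℚ)) =
      if c = d then exp (-1) else 1 := by
  split_ifs with hcd
  · rw [hcd, adicValuation_self]
  · rw [adicValuation_eq_one_iff]
    exact fun hdvd ↦ (cyclotomic.irreducible_rat hd).not_isUnit
      ((cyclotomic.isCoprime_rat (Ne.symm hcd)).isUnit_of_dvd hdvd)

theorem adicValuation_one_sub_X_pow {k : ℕ} (hk : 0 < k) :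
    adicValuation (cyclotomic.irreducible_rat hd) (1 - RatFunc.X ^ k) =
      if d ∣ k then exp (-1) else 1 := by
  rw [Valuation.map_sub_swap, ← RatFunc.algebraMap_X, ← map_pow, ← map_one (algebraMap ℚ[X] _),
    ← map_sub, ← prod_cyclotomic_eq_X_pow_sub_one hk, map_prod, map_prod]
  simp only [adicValuation_cyclotomic hd, Finset.prod_ite_eq', Nat.mem_divisors, hk.ne', ne_eq,
    not_false_eq_true, and_true]

theorem adicValuation_X : adicValuation (cyclotomic.irreducible_rat hd) RatFunc.X = 1 := by
  rw [← RatFunc.algebraMap_X, adicValuation_eq_one_iff]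
  intro hdvd
  have hone := dvd_sub (dvd_pow hdvd hd.ne') (cyclotomic.dvd_X_pow_sub_one d ℚ)
  rw [sub_sub_cancel] at hone
  exact (cyclotomic.irreducible_rat hd).not_isUnit (isUnit_of_dvd_one hone)

theorem isCyclotomicValuation_adicValuation :
    IsCyclotomicValuation (adicValuation (cyclotomic.irreducible_rat hd)) RatFunc.X d
      (exp (-1)) where
  map_base := adicValuation_X hd
  map_one_sub_zpow e he := by
    obtain ⟨k, rfl | rfl⟩ := e.eq_nat_or_neg
    · rw [zpow_natCast, adicValuation_one_sub_X_pow hd (by omega)]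
      simp only [Int.natCast_dvd_natCast]
    · have hneg : (1 : RatFunc ℚ) - RatFunc.X ^ (-k : ℤ) =
          -((1 - RatFunc.X ^ k) / RatFunc.X ^ k) := by
        have hX : (RatFunc.X : RatFunc ℚ) ≠ 0 := RatFunc.X_ne_zero
        rw [zpow_neg, zpow_natCast]
        field
      rw [hneg, Valuation.map_neg, map_div₀, map_pow, adicValuation_X hd, one_pow, div_one,
        adicValuation_one_sub_X_pow hd (by omega)]
      simp only [dvd_neg, Int.natCast_dvd_natCast]
  ne_zero := exp_ne_zero
  lt_one := by
    rw [← exp_zero, exp_lt_exp]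
    norm_num

theorem cyclotomic_sq_dvd_num {N M : ℕ} (hN : Odd N) (hdN : d ∣ N) (hdN' : d = N ∨ d % 4 = 3)
    (hM : M = (N - 1) / 2 ∨ M = N - 1) :
    cyclotomic d ℚ ^ 2 ∣ (truncatedSum RatFunc.X M - closedForm RatFunc.X N : RatFunc ℚ).num :=
  have hd : 0 < d := (hN.of_dvd_nat hdN).pos
  pow_dvd_num_of_adicValuation_le (cyclotomic.irreducible_rat hd) <|
    (isCyclotomicValuation_adicValuation hd).map_truncatedSum_sub_closedForm_le hN hdN hdN' hM

end Cyclotomic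

section Modulus

theorem ratCongr_prod_cyclotomic_sq {s : Finset ℕ} {A B : RatFunc ℚ}
    (h : ∀ d ∈ s, cyclotomic d ℚ ^ 2 ∣ (A - B).num) :
    RatCongr (∏ d ∈ s, cyclotomic d ℚ ^ 2) A B :=
  Finset.prod_dvd_of_coprime (fun _ _ _ _ hne ↦ (cyclotomic.isCoprime_rat hne).pow) h

theorem theorem3_general {N : ℕ} (hN : Odd N) :
    RatCongr (∏ d ∈ N.divisors with d = N ∨ d % 4 = 3, cyclotomic d ℚ ^ 2)
      (truncatedSum RatFunc.X ((N - 1) / 2)) (closedForm RatFunc.X N) ∧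
    RatCongr (∏ d ∈ N.divisors with d = N ∨ d % 4 = 3, cyclotomic d ℚ ^ 2)
      (truncatedSum RatFunc.X (N - 1)) (closedForm RatFunc.X N) := by
  have hdvd {M : ℕ} (hM : M = (N - 1) / 2 ∨ M = N - 1) :
      ∀ d ∈ N.divisors.filter fun d ↦ d = N ∨ d % 4 = 3, cyclotomic d ℚ ^ 2 ∣
        (truncatedSum RatFunc.X M - closedForm RatFunc.X N : RatFunc ℚ).num := fun d hd ↦ by
    rw [Finset.mem_filter, Nat.mem_divisors] at hd
    exact cyclotomic_sq_dvd_num hN hd.1.1 hd.2 hM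
  exact ⟨ratCongr_prod_cyclotomic_sq (hdvd (.inl rfl)),
    ratCongr_prod_cyclotomic_sq (hdvd (.inr rfl))⟩

theorem pow_odd_mod_four {n k : ℕ} (hn : n % 4 = 3) (hk : Odd k) : n ^ k % 4 = 3 := by
  obtain ⟨j, rfl⟩ := hk
  have hsq : n ^ 2 % 4 = 1 := by rw [Nat.pow_mod, hn]
  rw [pow_succ, pow_mul, Nat.mul_mod, Nat.pow_mod, hsq, one_pow, hn, Nat.one_mod, one_mul]

theorem modulus_dvd_prod_cyclotomic_sq {n : ℕ} (hn : n % 4 = 3) (r : ℕ) :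
    cyclotomic (n ^ (2 * r)) ℚ ^ 2 * ∏ j ∈ Finset.Icc 1 r, cyclotomic (n ^ (2 * j - 1)) ℚ ^ 2 ∣
      ∏ d ∈ (n ^ (2 * r)).divisors with d = n ^ (2 * r) ∨ d % 4 = 3, cyclotomic d ℚ ^ 2 := by
  have hinj : Function.Injective (n ^ ·) := Nat.pow_right_injective (by omega)
  have himage : Set.InjOn (fun j ↦ n ^ (2 * j - 1)) (Finset.Icc 1 r) := fun i hi j hj hij ↦ by
    have := hinj hij
    simp only [Finset.coe_Icc, Set.mem_Icc] at hi hj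
    omega
  have hnotMem : n ^ (2 * r) ∉ (Finset.Icc 1 r).image fun j ↦ n ^ (2 * j - 1) := fun hmem ↦ by
    obtain ⟨j, hj, hjr⟩ := Finset.mem_image.mp hmem
    have := hinj hjr
    rw [Finset.mem_Icc] at hj
    omega
  rw [← Finset.prod_image (f := fun d ↦ cyclotomic d ℚ ^ 2) himage,
    ← Finset.prod_insert (f := fun d ↦ cyclotomic d ℚ ^ 2) hnotMem]
  refine Finset.prod_dvd_prod_of_subset _ _ _ fun d hd ↦ ?_
  have hne : n ^ (2 * r) ≠ 0 := pow_ne_zero _ (by omega)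
  rw [Finset.mem_filter, Nat.mem_divisors]
  rcases Finset.mem_insert.mp hd with rfl | hd
  · exact ⟨⟨dvd_rfl, hne⟩, .inl rfl⟩
  · obtain ⟨j, hj, rfl⟩ := Finset.mem_image.mp hd
    rw [Finset.mem_Icc] at hj
    exact ⟨⟨pow_dvd_pow n (by omega), hne⟩,
      .inr (pow_odd_mod_four hn (Nat.odd_iff.mpr (by omega)))⟩

end Modulus

theorem theorem3 (n r : ℕ) (hn : n % 4 = 3) (hr : 1 ≤ r) :
    RatCongr
      (cyclotomic (n ^ (2 * r)) ℚ ^ 2 * ∏ j ∈ Finset.Icc 1 r, cyclotomic (n ^ (2 * j - 1)) ℚ ^ 2)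
      (truncatedSum (RatFunc.X : RatFunc ℚ) ((n ^ (2 * r) - 1) / 2))
      (closedForm (RatFunc.X : RatFunc ℚ) (n ^ (2 * r))) ∧
    RatCongr
      (cyclotomic (n ^ (2 * r)) ℚ ^ 2 * ∏ j ∈ Finset.Icc 1 r, cyclotomic (n ^ (2 * j - 1)) ℚ ^ 2)
      (truncatedSum (RatFunc.X : RatFunc ℚ) (n ^ (2 * r) - 1))
      (closedForm (RatFunc.X : RatFunc ℚ) (n ^ (2 * r))) := by
  have hdvd := modulus_dvd_prod_cyclotomic_sq hn r
  exact (theorem3_general (Nat.odd_iff.mpr (by omega)).pow).imp hdvd.trans hdvd.trans
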